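/- Theorem 5.3. Let $\Bbbk$ be a field of characteristic zero, let $n,k$ be integers with $0<k\le (n+1)/2$, and let $\alpha_1,\dots,\alpha_{n+2}\in\Bbbk$ be pairwise distinct. For $i=1,\dots,n+2$ put $\ell_i=\sum_{j=1}^{n}\alpha_i^{j-1}x_j$, and let polynomials act on $\Bbbk[x_1,\dots,x_n]$ by letting $x_j$ act as $\partial/\partial x_j$ (written $f\circ G$). Let \[ F=\det\begin{bmatrix} 1&\alpha_1&\alpha_1^2&\cdots&\alpha_1^{n-k}\\ \vdots&\vdots&\vdots&&\vdots\\ 1&\alpha_{n-2k+1}&\alpha_{n-2k+1}^2&\cdots&\alpha_{n-2k+1}^{n-k}\\ x_1&x_2&x_3&\cdots&x_{n+1-k}\\ x_2&x_3&x_4&\cdots&x_{n+2-k}\\ \vdots&\vdots&\vdots&&\vdots\\ x_k&x_{k+1}&x_{k+2}&\cdots&x_n \end{bmatrix}. \] Then $F$ is, up to scalar multiples, the unique nonzero form of degree $k$ in $\Bbbk[x_1,\dots,x_n]$ that is annihilated by $\ell_1,\dots,\ell_{n-2k+1}$ and by the squares $\ell_{n-2k+2}^2,\dots,\ell_{n+2}^2$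 of the remaining $2k+1$ linear forms. That is, $F\neq 0$, and a polynomial $G$ is homogeneous of degree $k$ with $\ell_i\circ G=0$ for $1\le i\le n-2k+1$ and $\ell_i^2\circ G=0$ for $n-2k+2\le i\le n+2$ if and only if $G=cF$ for some $c\in\Bbbk$. -/

import Mathlib

open MvPolynomial

noncomputable section

namespace InverseSystem

/-- The partial derivative `∂/∂X i` as a `K`-linear operator on polynomials. -/
def partialOp {σ : Type*} (K : Type*) [Field K] (i : σ) : Module.End K (MvPolynomial σ K) :=
  (pderiv i : Derivation K (MvPolynomial σ K) (MvPolynomial σ K)).toLinearMap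

theorem commute_partialOp {σ K : Type*} [Field K] (i j : σ) :
    Commute (partialOp K i) (partialOp K j) := by
  classical
  have h : ⁅(pderiv i : Derivation K (MvPolynomial σ K) (MvPolynomial σ K)),
      (pderiv j : Derivation K (MvPolynomial σ K) (MvPolynomial σ K))⁆ = 0 := by
    apply MvPolynomial.derivation_ext
    intro l
    rw [Derivation.commutator_apply]
    simp only [pderiv_X, Derivation.coe_zero, Pi.zero_apply]
    simp only [Pi.single_apply]
    split_ifs <;> simp
  apply LinearMap.ext
  intro p
  have := congrArg (fun D => D p) h
  simp only [Derivation.commutator_apply, Derivation.coe_zero, Pi.zero_apply] at this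
  exact sub_eq_zero.mp this

theorem pairwise_commute {σ K : Type*} [Field K] (s : Finset σ) (m m' : σ → ℕ) :
    (s : Set σ).Pairwise fun i j => Commute (partialOp K i ^ m i) (partialOp K j ^ m' j) :=
  fun i _ j _ _ => (commute_partialOp i j).pow_pow _ _

/-- The differential operator `∏ i, (∂/∂X i) ^ m i` attached to the monomial `∏ i, x i ^ m i`. -/
def monomialOp {σ : Type*} [Fintype σ] (K : Type*) [Field K] :
    Multiplicative (σ →₀ ℕ) →* Module.End K (MvPolynomial σ K) where
  toFun m := Finset.univ.noncommProd (fun i => partialOp K i ^ (Multiplicative.toAdd m) i)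
    (pairwise_commute _ _ _)
  map_one' := (Finset.noncommProd_eq_pow_card _ _ _ 1 (by intro i _; simp)).trans (one_pow _)
  map_mul' a b := by
    refine Eq.trans ?_ (Finset.noncommProd_mul_distrib _ _ (pairwise_commute _ _ _)
      (pairwise_commute _ _ _) (pairwise_commute _ _ _))
    exact Finset.noncommProd_congr rfl (fun i _ => by simp [pow_add]) _

/-- The action of a polynomial `f` on polynomials in which `x i` acts as `∂/∂X i`; it is the
`K`-algebra homomorphism that sends `x i` to `∂/∂X i`. We have `diffOp f F = f ∘ F`. -/
def diffOp {σ K : Type*} [Fintype σ] [Field K] :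
    MvPolynomial σ K →ₐ[K] Module.End K (MvPolynomial σ K) :=
  AddMonoidAlgebra.lift K (Module.End K (MvPolynomial σ K)) (σ →₀ ℕ) (monomialOp K)

/-- The variable `x i` acts as `∂/∂X i`. -/
theorem diffOp_X {σ K : Type*} [Fintype σ] [Field K] (i : σ) (F : MvPolynomial σ K) :
    diffOp (X i) F = pderiv i F := by
  classical
  have h : diffOp (X i : MvPolynomial σ K) = monomialOp K (Multiplicative.ofAdd
      (Finsupp.single i 1)) := by
    change AddMonoidAlgebra.lift K _ _ (monomialOp K) (AddMonoidAlgebra.single _ _) = _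
    rw [AddMonoidAlgebra.lift_single, one_smul]
  have h2 : monomialOp K (Multiplicative.ofAdd (Finsupp.single i 1)) = partialOp K i := by
    refine (Finset.noncommProd_erase_mul Finset.univ (Finset.mem_univ i) _
      (pairwise_commute _ _ _) (pairwise_commute _ _ _)).symm.trans ?_
    have h3 : (Finset.univ.erase i).noncommProd
        (fun j => partialOp K j ^ (Finsupp.single i 1 : σ →₀ ℕ) j) (pairwise_commute _ _ _) = 1 :=
      (Finset.noncommProd_eq_pow_card _ _ _ 1 (fun j hj => by
        rw [Finsupp.single_eq_of_ne (Finset.ne_of_mem_erase hj), pow_zero])).trans (one_pow _)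
    refine (congrArg₂ (· * ·) h3 (?_ : _ = partialOp K i)).trans (one_mul _)
    simp
  rw [h, h2]
  rfl

end InverseSystem

/-- The linear form `∑ j, a ^ j x_j` (with `j = 0, …, n - 1`) of the point with parameter `a` on
the moment curve. -/
def momentForm {K : Type*} [Field K] (n : ℕ) (a : K) : MvPolynomial (Fin n) K :=
  ∑ j : Fin n, C (a ^ (j : ℕ)) * X j

/-- The square matrix of size `n + 1 - k` whose first `n - 2k + 1` rows are the Vandermonde rows
`1, α_i, α_i ^ 2, …, α_i ^ (n - k)` and whose last `k` rows are the Hankel rows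
`x_s, x_{s+1}, …, x_{s + n - k}`. All indices start at `0`. -/
def vandermondeHankel {K : Type*} [Field K] (n k : ℕ) (hkn : 2 * k ≤ n + 1)
    (α : Fin (n + 2) → K) :
    Matrix (Fin (n + 1 - k)) (Fin (n + 1 - k)) (MvPolynomial (Fin n) K) :=
  Matrix.of fun r c =>
    if h : (r : ℕ) < n + 1 - 2 * k then
      C (α ⟨r, by omega⟩ ^ (c : ℕ))
    else
      X ⟨(r : ℕ) - (n + 1 - 2 * k) + c, by omega⟩

end

/-! Put m = n+1-2k and let `N` be the set of the 2k+1 indices i ≥ m. Each Hankel row of F,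
differentiated along ℓ_a, becomes a multiple of the constant row (1, a, a², …). Hence ℓ_i ∘ F and
ℓ_i² ∘ F vanish because rows repeat (`isInverseForm_det_vandermondeHankel`). Evaluation at a sum of
k points of the moment curve shows F ≠ 0 (`det_vandermondeHankel_ne_zero`).

For uniqueness, a solution G is encoded by its mixed derivatives ℓ_S ∘ G for k-subsets S of `N`,
which are constants; if all vanish, so does G. The n+2 forms ℓ_i satisfy two linear relations, with
coefficients u_i and u_i α_i. Multiplied by ℓ_T with |T| = k-1 and applied to G, they give two
linear systems for h(S) = ∏_{i ∈ S} u_i · ℓ_S ∘ G (`IsInverseForm.isDownSolution`).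

The core is combinatorial: on 2k+1 points such an h is determined by any single value
(`IsDownSolution.eq_zero`). The induction on k removes two points and passes to complements; the
relations needed after complementation come from sl₂-type arguments in the Boolean lattice. Two
solutions can therefore be compared through one mixed derivative. -/

section SetFunctions

variable {ι K M : Type*} [DecidableEq ι] [Field K] [AddCommGroup M] [Module K M]

/-! ### Up and down operators on the Boolean lattice -/

/-- The down operator on set functions, relative to the ground set `N`. -/
def downOp (N : Finset ι) (f : Finset ι → M) (T : Finset ι) : M :=
  ∑ i ∈ N \ T, f (insert i T)

/-- The up operator on set functions. -/
def upOp (f : Finset ι → M) (U : Finset ι) : M :=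
  ∑ i ∈ U, f (U.erase i)

/-- The sl₂ commutation relation. Adding i and removing j ≠ i commute, so only the diagonal terms
differ: |N \ S| copies of f(S) against |S| copies. -/
theorem downOp_upOp (K : Type*) [Field K] [Module K M] {N S : Finset ι} (hS : S ⊆ N)
    (f : Finset ι → M) :
    downOp N (upOp f) S =
      upOp (downOp N f) S + ((N.card : K) - 2 * (S.card : K)) • f S := by
  have h1 : downOp N (upOp f) S = ((N \ S).card : K) • f S +
      ∑ i ∈ N \ S, ∑ j ∈ S, f (insert i (S.erase j)) := by
    rw [Nat.cast_smul_eq_nsmul, ← Finset.sum_const, ← Finset.sum_add_distrib]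
    refine Finset.sum_congr rfl fun i hi => ?_
    have hiS : i ∉ S := (Finset.mem_sdiff.1 hi).2
    rw [upOp, Finset.sum_insert hiS, Finset.erase_insert hiS]
    congr 1
    refine Finset.sum_congr rfl fun j hj => ?_
    rw [Finset.erase_insert_of_ne (by rintro rfl; exact hiS hj)]
  have h2 : upOp (downOp N f) S = (S.card : K) • f S +
      ∑ j ∈ S, ∑ i ∈ N \ S, f (insert i (S.erase j)) := by
    rw [Nat.cast_smul_eq_nsmul, ← Finset.sum_const, ← Finset.sum_add_distrib]
    refine Finset.sum_congr rfl fun j hj => ?_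
    have : N \ S.erase j = insert j (N \ S) := by
      ext l
      simp only [Finset.mem_sdiff, Finset.mem_erase, Finset.mem_insert]
      by_cases h : l = j
      · subst h; simp [hS hj]
      · simp [h]
    rw [downOp, this, Finset.sum_insert (by simp [hj]), Finset.insert_erase hj]
  rw [h1, h2, Finset.sum_comm, Finset.card_sdiff_of_subset hS,
    Nat.cast_sub (Finset.card_le_card hS)]
  module

theorem downOp_congr {N T : Finset ι} (hT : T ⊆ N) {f g : Finset ι → M}
    (h : ∀ S ⊆ N, S.card = T.card + 1 → f S = g S) : downOp N f T = downOp N g T := by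
  refine Finset.sum_congr rfl fun i hi => ?_
  rw [Finset.mem_sdiff] at hi
  exact h _ (Finset.insert_subset hi.1 hT) (Finset.card_insert_of_notMem hi.2)

theorem upOp_congr {N U : Finset ι} (hU : U ⊆ N) {f g : Finset ι → M}
    (h : ∀ S ⊆ N, S.card + 1 = U.card → f S = g S) : upOp f U = upOp g U := by
  refine Finset.sum_congr rfl fun i hi => ?_
  exact h _ ((Finset.erase_subset _ _).trans hU) (Finset.card_erase_add_one hi)

theorem upOp_smul (c : K) (f : Finset ι → M) (U : Finset ι) :
    upOp (fun S => c • f S) U = c • upOp f U :=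
  (Finset.smul_sum).symm

theorem downOp_sub (N : Finset ι) (f g : Finset ι → M) (U : Finset ι) :
    downOp N (fun S => f S - g S) U = downOp N f U - downOp N g U :=
  Finset.sum_sub_distrib _ _

theorem upOp_zero (U : Finset ι) : upOp (fun _ => (0 : M)) U = 0 :=
  Finset.sum_const_zero

theorem downOp_zero (N U : Finset ι) : downOp N (fun _ => (0 : M)) U = 0 :=
  Finset.sum_const_zero

theorem downOp_prod_smul (N : Finset ι) (c : ι → K) (g : Finset ι → M) (T : Finset ι) :
    downOp N (fun S => (∏ i ∈ S, c i) • g S) T =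
      (∏ i ∈ T, c i) • ∑ i ∈ N \ T, c i • g (insert i T) := by
  rw [downOp, Finset.smul_sum]
  refine Finset.sum_congr rfl fun i hi => ?_
  rw [Finset.prod_insert (Finset.mem_sdiff.1 hi).2, smul_smul, mul_comm]

/-- The set function `h` satisfies the two down relations with weights `1` and `b` at level `k`. -/
def IsDownSolution (N : Finset ι) (k : ℕ) (b : ι → K) (h : Finset ι → M) : Prop :=
  ∀ T ⊆ N, T.card + 1 = k →
    ∑ i ∈ N \ T, h (insert i T) = 0 ∧ ∑ i ∈ N \ T, b i • h (insert i T) = 0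

theorem sdiff_eq_insert_of_erase_erase {N T : Finset ι} {x y : ι} (hx : x ∈ N) (hy : y ∈ N)
    (hxy : x ≠ y) (hT : T ⊆ (N.erase x).erase y) :
    N \ T = insert x (insert y (((N.erase x).erase y) \ T)) := by
  have hxT : x ∉ T := fun h => by simpa using hT h
  have hyT : y ∉ T := fun h => by simpa using hT h
  ext l
  simp only [Finset.mem_sdiff, Finset.mem_insert, Finset.mem_erase]
  by_cases h1 : l = x
  · subst h1; simp [hx, hxT]
  · by_cases h2 : l = y
    · subst h2; simp [hy, hyT]
    · simp [h1, h2]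

/-- Choosing z = b v makes the term of the point v disappear. -/
theorem IsDownSolution.shift {N : Finset ι} {k : ℕ} {b : ι → K} {h : Finset ι → M}
    (hh : IsDownSolution N k b h) (z : K) {T : Finset ι} (hT : T ⊆ N) (hTk : T.card + 1 = k) :
    ∑ i ∈ N \ T, (b i - z) • h (insert i T) = 0 := by
  obtain ⟨h1, h2⟩ := hh T hT hTk
  simp only [sub_smul, Finset.sum_sub_distrib, ← Finset.smul_sum, h1, h2, smul_zero, sub_zero]

variable [CharZero K]

/-- Above the middle level, `upOp ∘ downOp` has no eigenvalue `-c` with `c` natural. -/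
theorem eq_zero_of_upOp_downOp_eq (N : Finset ι) (d : ℕ) :
    ∀ (j c : ℕ) (y : Finset ι → M), N.card < 2 * j → N.card < j + d →
      (∀ S ⊆ N, S.card = j → upOp (downOp N y) S = (-(c : K)) • y S) →
      ∀ S ⊆ N, S.card = j → y S = 0 := by
  induction d with
  | zero =>
    intro j c y _ h _ S hS hj
    have := Finset.card_le_card hS
    omega
  | succ d ih =>
    intro j c y h2 hd hy S hS hj
    -- The commutator adds |N| - 2j < 0, so the new eigenvalue is again minus a natural number, now
    -- nonzero. The function `upOp y` then satisfies the same hypothesis one level higher.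
    have key : ∀ S ⊆ N, S.card = j →
        downOp N (upOp y) S = (-((c + (2 * j - N.card) : ℕ) : K)) • y S := by
      intro S hS hj
      rw [downOp_upOp K hS, hy S hS hj, hj, Nat.cast_add, Nat.cast_sub h2.le]
      push_cast
      module
    have hup : ∀ U ⊆ N, U.card = j + 1 → upOp y U = 0 := by
      refine ih (j + 1) (c + (2 * j - N.card)) (upOp y) (by omega) (by omega) ?_
      intro U hU hUj
      rw [← upOp_smul]
      exact upOp_congr hU fun S hS h => key S hS (by omega)
    have h0 : downOp N (upOp y) S = 0 := by
      rw [downOp_congr hS (g := fun _ => 0) fun U hU h => hup U hU (by omega), downOp_zero]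
    rw [key S hS hj, smul_eq_zero, neg_eq_zero, Nat.cast_eq_zero] at h0
    exact h0.resolve_left (by omega)

/-- The down operator is injective above the middle level. -/
theorem eq_zero_of_downOp_eq_zero (K : Type*) [Field K] [CharZero K] [Module K M]
    {N : Finset ι} {j : ℕ} (hj : N.card < 2 * j)
    {y : Finset ι → M} (hy : ∀ T ⊆ N, T.card + 1 = j → downOp N y T = 0) :
    ∀ S ⊆ N, S.card = j → y S = 0 := by
  refine eq_zero_of_upOp_downOp_eq (K := K) N (N.card + 1) j 0 y hj (by omega) ?_
  intro S hS hSj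
  rw [upOp_congr hS (g := fun _ => 0) fun T hT h => hy T hT (by omega), upOp_zero]
  simp

/-- Write D, U for down and up. As |N| = 2k-1, DUg = UDg - g at level k, and D(UDg) = UDDg + Dg = Dg
at level k-1. So D²Ug = 0, and D is injective at levels k+1 and k. -/
theorem upOp_eq_zero_of_downOp_downOp (K : Type*) [Field K] [CharZero K] [Module K M]
    {N : Finset ι} {k : ℕ} (hN : N.card + 1 = 2 * k)
    {g : Finset ι → M} (hg : ∀ R ⊆ N, R.card + 2 = k → downOp N (downOp N g) R = 0) :
    ∀ U ⊆ N, U.card = k + 1 → upOp g U = 0 := by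
  have hNK : (N.card : K) = 2 * k - 1 := by
    rw [eq_sub_iff_add_eq]; exact_mod_cast hN
  refine eq_zero_of_downOp_eq_zero K (by omega) fun S hS hSk => ?_
  refine eq_zero_of_downOp_eq_zero K (j := k) (by omega) (fun T hT hTk => ?_) S hS (by omega)
  have h1 : downOp N (downOp N (upOp g)) T =
      downOp N (fun S => upOp (downOp N g) S - g S) T := by
    refine downOp_congr hT fun S hS h => ?_
    rw [downOp_upOp K hS, hNK, h, hTk]
    module
  have hTK : (T.card : K) = k - 1 := by
    rw [eq_sub_iff_add_eq]; exact_mod_cast hTk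
  rw [h1, downOp_sub, downOp_upOp K hT, hNK, hTK,
    upOp_congr hT (g := fun _ => 0) fun R hR h => hg R hR (by omega), upOp_zero]
  module

/-- Scaling g(S) by ∏_{i ∈ S} c_i turns the weighted down relations into unweighted ones; on the up
side the same scaling leaves the weights 1/c_i. -/
theorem sum_inv_smul_eq_zero {N : Finset ι} {k : ℕ} (hN : N.card + 1 = 2 * k) {c : ι → K}
    (hc : ∀ i ∈ N, c i ≠ 0) {g : Finset ι → M}
    (hg : ∀ R ⊆ N, R.card + 2 = k →
      ∑ i ∈ N \ R, c i • ∑ j ∈ N \ insert i R, c j • g (insert j (insert i R)) = 0)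
    {U : Finset ι} (hU : U ⊆ N) (hUk : U.card = k + 1) :
    ∑ i ∈ U, (c i)⁻¹ • g (U.erase i) = 0 := by
  have h := upOp_eq_zero_of_downOp_downOp K hN (g := fun S => (∏ i ∈ S, c i) • g S)
    (fun R hR hRk => ?_) U hU hUk
  · have h2 : upOp (fun S => (∏ i ∈ S, c i) • g S) U =
        (∏ i ∈ U, c i) • ∑ i ∈ U, (c i)⁻¹ • g (U.erase i) := by
      rw [upOp, Finset.smul_sum]
      refine Finset.sum_congr rfl fun i hi => ?_
      rw [← Finset.mul_prod_erase U c hi, smul_smul, mul_right_comm,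
        mul_inv_cancel₀ (hc i (hU hi)), one_mul]
    rw [h2, smul_eq_zero] at h
    exact h.resolve_left (Finset.prod_ne_zero_iff.2 fun i hi => hc i (hU hi))
  · have h2 : downOp N (fun S => (∏ i ∈ S, c i) • g S) = fun T =>
        (∏ i ∈ T, c i) • ∑ i ∈ N \ T, c i • g (insert i T) :=
      funext fun T => downOp_prod_smul N c g T
    rw [h2, downOp_prod_smul, hg R hR hRk, smul_zero]

/-! ### Rigidity of the two down relations -/

/-- A solution of the two down relations at level `k` on `2 * k + 1` points is determined by
any one of its values. -/
theorem IsDownSolution.eq_zero (k : ℕ) : ∀ (N : Finset ι) (b : ι → K) (h : Finset ι → M)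
    (S₀ : Finset ι), N.card = 2 * k + 1 → Set.InjOn b N → IsDownSolution N k b h →
    S₀ ⊆ N → S₀.card = k → h S₀ = 0 → ∀ S ⊆ N, S.card = k → h S = 0 := by
  induction k with
  | zero =>
    intro N b h S₀ _ _ _ _ hS₀k h0 S _ hSk
    rw [Finset.card_eq_zero] at hS₀k hSk
    rwa [hSk, ← hS₀k]
  | succ k ih =>
    intro N b h S₀ hN hb hh hS₀ hS₀k h0 S hS hSk
    obtain ⟨x, hx, y, hy, hxy⟩ := Finset.one_lt_card.1
      (show 1 < (N \ S₀).card by rw [Finset.card_sdiff_of_subset hS₀]; omega)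
    rw [Finset.mem_sdiff] at hx hy
    set N' := (N.erase x).erase y with hN'
    have hN'N : N' ⊆ N := (Finset.erase_subset _ _).trans (Finset.erase_subset _ _)
    have hN'c : N'.card = 2 * k + 1 := by
      rw [Finset.card_erase_of_mem (Finset.mem_erase.2 ⟨hxy.symm, hy.1⟩),
        Finset.card_erase_of_mem hx.1]
      omega
    have hS₀N' : S₀ ⊆ N' := fun i hi => Finset.mem_erase.2 ⟨by rintro rfl; exact hy.2 hi,
      Finset.mem_erase.2 ⟨by rintro rfl; exact hx.2 hi, hS₀ hi⟩⟩
    have hxN' : x ∉ N' := by simp [hN']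
    have hyN' : y ∉ N' := by simp [hN']
    have hbx : ∀ i ∈ N', b i - b x ≠ 0 := fun i hi h => hxN' <| by
      rwa [← hb (hN'N hi) hx.1 (sub_eq_zero.1 h)]
    have hby : ∀ i ∈ N', b i - b y ≠ 0 := fun i hi h => hyN' <| by
      rwa [← hb (hN'N hi) hy.1 (sub_eq_zero.1 h)]
    have hbxy : b x - b y ≠ 0 := fun h => hxy (hb hx.1 hy.1 (sub_eq_zero.1 h))
    -- the values on sets containing exactly one of the two removed points
    have one (u v : ι) (hu : u ∈ N) (hv : v ∈ N) (huv : u ≠ v) (hE : N' = (N.erase u).erase v)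
        (T : Finset ι) (hT : T ⊆ N') (hTk : T.card = k) :
        ∑ i ∈ N' \ T, (b i - b v) • h (insert i T) = -((b u - b v) • h (insert u T)) := by
      have h1 := hh.shift (b v) (hT.trans hN'N) (by omega)
      rw [sdiff_eq_insert_of_erase_erase hu hv huv (hE ▸ hT), ← hE, Finset.sum_insert,
        Finset.sum_insert, sub_self, zero_smul, zero_add] at h1
      · exact eq_neg_of_add_eq_zero_right h1
      · simp [hE]
      · simp [hE, huv]
    -- Here `u` already lies in the set and `v` has weight zero, so the relation involves only
    -- points of `N'`.
    have two (u v : ι) (hu : u ∈ N) (hv : v ∈ N) (huv : u ≠ v) (hE : N' = (N.erase u).erase v)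
        (R : Finset ι) (hR : R ⊆ N') (hRk : R.card + 1 = k) :
        ∑ i ∈ N' \ R, (b i - b v) • h (insert u (insert i R)) = 0 := by
      have huN' : u ∉ N' := by simp [hE]
      have h1 := hh.shift (b v) (T := insert u R)
        (Finset.insert_subset hu (hR.trans hN'N))
        (by rw [Finset.card_insert_of_notMem fun h => huN' (hR h)]; omega)
      have h2 : N \ insert u R = insert v (N' \ R) := by
        rw [Finset.sdiff_insert, sdiff_eq_insert_of_erase_erase hu hv huv (hE ▸ hR), ← hE,
          Finset.erase_insert]
        simp [hE, huv]
      rw [h2, Finset.sum_insert (by simp [hE]), sub_self, zero_smul, zero_add] at h1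
      rw [← h1]
      exact Finset.sum_congr rfl fun i _ => by rw [Finset.insert_comm]
    -- By `one`, a weighted down step on `N'` produces a multiple of h(T ∪ {u}); by `two`, a second
    -- step kills it.
    have quad (u v : ι) (hu : u ∈ N) (hv : v ∈ N) (huv : u ≠ v)
        (hE : N' = (N.erase u).erase v) (hbv : ∀ i ∈ N', b i - b v ≠ 0)
        (U : Finset ι) (hU : U ⊆ N') (hUk : U.card = k + 2) :
        ∑ i ∈ U, (b i - b v)⁻¹ • h (U.erase i) = 0 := by
      refine sum_inv_smul_eq_zero (N := N') (k := k + 1) (by omega) hbv (fun R hR hRk => ?_)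
        hU hUk
      have h1 : ∀ i ∈ N' \ R, (b i - b v) • ∑ j ∈ N' \ insert i R,
          (b j - b v) • h (insert j (insert i R)) =
          (-(b u - b v)) • (b i - b v) • h (insert u (insert i R)) := by
        intro i hi
        rw [Finset.mem_sdiff] at hi
        rw [one u v hu hv huv hE _ (Finset.insert_subset hi.1 hR)
          (by rw [Finset.card_insert_of_notMem hi.2]; omega)]
        module
      rw [Finset.sum_congr rfl h1, ← Finset.smul_sum, two u v hu hv huv hE R hR (by omega),
        smul_zero]
    have hE' : N' = (N.erase y).erase x := Finset.erase_right_comm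
    -- complementation reduces to level `k`
    have comp : ∀ S ⊆ N', S.card = k → h (N' \ S) = 0 := by
      -- On complements, `quad` for the two removed points gives relations with weights 1/(b i - b
      -- y) and 1/(b i - b x). Absorbing the first into the function leaves 1 and their quotient, a
      -- Möbius function of `b i`, hence injective.
      have h3 := ih N' (fun i => (b i - b y) * (b i - b x)⁻¹)
        (fun S => (∏ i ∈ S, (b i - b y)⁻¹) • h (N' \ S)) (N' \ S₀) hN'c ?_ ?_
        Finset.sdiff_subset (by rw [Finset.card_sdiff_of_subset hS₀N']; omega) ?_
      · intro S hS hSk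
        exact (smul_eq_zero.1 (h3 S hS hSk)).resolve_left
          (Finset.prod_ne_zero_iff.2 fun i hi => inv_ne_zero (hby i (hS hi)))
      · intro i hi j hj hij
        have hi' := hbx i hi
        have hj' := hbx j hj
        refine hb (hN'N hi) (hN'N hj) ?_
        simp only [← div_eq_mul_inv] at hij
        rw [div_eq_div_iff hi' hj'] at hij
        have : (b x - b y) * (b i - b j) = 0 := by linear_combination -hij
        exact sub_eq_zero.1 ((mul_eq_zero.1 this).resolve_left hbxy)
      · intro T hT hTk
        have hU : (N' \ T).card = k + 2 := by rw [Finset.card_sdiff_of_subset hT]; omega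
        have q1 := quad x y hx.1 hy.1 hxy rfl hby (N' \ T) Finset.sdiff_subset hU
        have q2 := quad y x hy.1 hx.1 hxy.symm hE' hbx (N' \ T) Finset.sdiff_subset hU
        constructor
        · rw [← smul_zero (∏ i ∈ T, (b i - b y)⁻¹), ← q1, Finset.smul_sum]
          refine Finset.sum_congr rfl fun i hi => ?_
          beta_reduce
          rw [Finset.prod_insert (Finset.mem_sdiff.1 hi).2, Finset.sdiff_insert, smul_smul,
            mul_comm]
        · rw [← smul_zero (∏ i ∈ T, (b i - b y)⁻¹), ← q2, Finset.smul_sum]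
          refine Finset.sum_congr rfl fun i hi => ?_
          beta_reduce
          rw [Finset.prod_insert (Finset.mem_sdiff.1 hi).2, Finset.sdiff_insert, smul_smul,
            smul_smul]
          congr 1
          have := hby i (Finset.mem_sdiff.1 hi).1
          field_simp
      · simp only [Finset.sdiff_sdiff_eq_self hS₀N', h0, smul_zero]
    have base : ∀ S ⊆ N', S.card = k + 1 → h S = 0 := by
      intro S hS hSk
      rw [← Finset.sdiff_sdiff_eq_self hS]
      exact comp _ Finset.sdiff_subset (by rw [Finset.card_sdiff_of_subset hS]; omega)
    have single (u v : ι) (hu : u ∈ N) (hv : v ∈ N) (huv : u ≠ v)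
        (hE : N' = (N.erase u).erase v) (T : Finset ι) (hT : T ⊆ N') (hTk : T.card = k) :
        h (insert u T) = 0 := by
      have h1 := one u v hu hv huv hE T hT hTk
      rw [Finset.sum_eq_zero, eq_comm, neg_eq_zero, smul_eq_zero] at h1
      · exact h1.resolve_left fun h => huv (hb hu hv (sub_eq_zero.1 h))
      · intro i hi
        rw [Finset.mem_sdiff] at hi
        rw [base _ (Finset.insert_subset hi.1 hT)
          (by rw [Finset.card_insert_of_notMem hi.2, hTk]), smul_zero]
    have mem_N' {T : Finset ι} (hT : T ⊆ N) (h1 : x ∉ T) (h2 : y ∉ T) : T ⊆ N' :=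
      fun i hi => Finset.mem_erase.2 ⟨by rintro rfl; exact h2 hi,
        Finset.mem_erase.2 ⟨by rintro rfl; exact h1 hi, hT hi⟩⟩
    by_cases hxS : x ∈ S
    · obtain ⟨T, hxT, rfl⟩ : ∃ T, x ∉ T ∧ S = insert x T :=
        ⟨S.erase x, by simp, (Finset.insert_erase hxS).symm⟩
      rw [Finset.card_insert_of_notMem hxT] at hSk
      have hTN : T ⊆ N := (Finset.subset_insert _ _).trans hS
      by_cases hyT : y ∈ T
      · obtain ⟨R, hyR, rfl⟩ : ∃ R, y ∉ R ∧ T = insert y R :=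
          ⟨T.erase y, by simp, (Finset.insert_erase hyT).symm⟩
        rw [Finset.card_insert_of_notMem hyR] at hSk
        have hxR : x ∉ R := fun h => hxT (Finset.mem_insert_of_mem h)
        have hRN' : R ⊆ N' := mem_N' ((Finset.subset_insert _ _).trans hTN) hxR hyR
        -- In this relation every other term contains `x` but not `y`, so it vanishes by `single`.
        have h1 := (hh (insert x R) (Finset.insert_subset hx.1 (hRN'.trans hN'N))
          (by rw [Finset.card_insert_of_notMem hxR]; omega)).1
        have h2 : N \ insert x R = insert y (N' \ R) := by
          rw [Finset.sdiff_insert, sdiff_eq_insert_of_erase_erase hx.1 hy.1 hxy hRN',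
            Finset.erase_insert]
          simp [hxy]
        rw [h2, Finset.sum_insert (by simp [hN']), Finset.sum_eq_zero, add_zero] at h1
        · rwa [Finset.insert_comm]
        · intro i hi
          rw [Finset.mem_sdiff] at hi
          rw [Finset.insert_comm]
          exact single x y hx.1 hy.1 hxy rfl _ (Finset.insert_subset hi.1 hRN')
            (by rw [Finset.card_insert_of_notMem hi.2]; omega)
      · exact single x y hx.1 hy.1 hxy rfl T (mem_N' hTN hxT hyT) (by omega)
    · by_cases hyS : y ∈ S
      · obtain ⟨T, hyT, rfl⟩ : ∃ T, y ∉ T ∧ S = insert y T :=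
          ⟨S.erase y, by simp, (Finset.insert_erase hyS).symm⟩
        rw [Finset.card_insert_of_notMem hyT] at hSk
        exact single y x hy.1 hx.1 hxy.symm hE' T
          (mem_N' ((Finset.subset_insert _ _).trans hS)
            (fun h => hxS (Finset.mem_insert_of_mem h)) hyT) (by omega)
      · exact base S (mem_N' hS hxS hyS) hSk

end SetFunctions

/-! ### Derivatives along the moment curve -/

open InverseSystem

theorem diffOp_momentForm {K : Type*} [Field K] (n : ℕ) (a : K) (G : MvPolynomial (Fin n) K) :
    diffOp (momentForm n a) G = ∑ j : Fin n, C (a ^ (j : ℕ)) * pderiv j G := by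
  simp only [momentForm, map_sum, map_mul, LinearMap.sum_apply, Module.End.mul_apply, diffOp_X,
    ← algebraMap_eq, AlgHom.commutes, Module.algebraMap_end_apply, Algebra.smul_def]

/-- The derivative in the direction of the point with parameter `a` on the moment curve. -/
noncomputable def momentDerivation {K : Type*} [Field K] (n : ℕ) (a : K) :
    Derivation K (MvPolynomial (Fin n) K) (MvPolynomial (Fin n) K) :=
  mkDerivation K fun j => C (a ^ (j : ℕ))

/-- Makes the Leibniz rule, and with it the row-by-row derivative of a determinant, available for
the action of ℓ_a. -/
theorem diffOp_momentForm_eq {K : Type*} [Field K] (n : ℕ) (a : K)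
    (G : MvPolynomial (Fin n) K) :
    diffOp (momentForm n a) G = momentDerivation n a G := by
  rw [diffOp_momentForm]
  have hsum (p : MvPolynomial (Fin n) K) :
      (∑ j : Fin n, (C (a ^ (j : ℕ)) : MvPolynomial (Fin n) K) • pderiv (R := K) j) p =
        ∑ j : Fin n, C (a ^ (j : ℕ)) * pderiv j p := by
    rw [← Derivation.coeFnAddMonoidHom_apply, map_sum, Finset.sum_apply]
    rfl
  rw [← hsum]
  congr 1
  apply derivation_ext
  intro i
  rw [hsum, momentDerivation, mkDerivation_X, Finset.sum_eq_single i]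
  · rw [pderiv_X_self, mul_one]
  · intro j _ hj
    rw [pderiv_X_of_ne hj.symm, mul_zero]
  · simp

theorem Derivation.map_prod {ι R A : Type*} [CommRing R] [CommRing A] [Algebra R A]
    [DecidableEq ι] (D : Derivation R A A) (f : ι → A) (s : Finset ι) :
    D (∏ i ∈ s, f i) = ∑ i ∈ s, D (f i) * ∏ j ∈ s.erase i, f j := by
  induction s using Finset.induction_on with
  | empty => simp
  | insert a s ha ih =>
    rw [Finset.prod_insert ha, D.leibniz, ih, Finset.sum_insert ha, Finset.erase_insert ha,
      smul_eq_mul, smul_eq_mul, add_comm, mul_comm (∏ i ∈ s, f i), Finset.mul_sum]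
    congr 1
    refine Finset.sum_congr rfl fun i hi => ?_
    have hai : a ≠ i := by rintro rfl; exact ha hi
    rw [Finset.erase_insert_of_ne hai, Finset.prod_insert (by simp [ha])]
    ring

/-- The derivative of a determinant, row by row. -/
theorem Derivation.map_det {R A n : Type*} [CommRing R] [CommRing A] [Algebra R A] [Fintype n]
    [DecidableEq n] (D : Derivation R A A) (M : Matrix n n A) :
    D M.det = ∑ r, (M.updateRow r fun c => D (M r c)).det := by
  have hdet (B : Matrix n n A) :
      B.det = ∑ σ : Equiv.Perm n, Equiv.Perm.sign σ • ∏ i, B i (σ i) := by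
    rw [← Matrix.det_transpose, Matrix.det_apply]
    rfl
  simp only [hdet, map_sum]
  rw [Finset.sum_comm]
  refine Finset.sum_congr rfl fun σ _ => ?_
  rw [← Finset.smul_sum, Units.smul_def, Units.smul_def, map_zsmul, D.map_prod]
  congr 1
  refine Finset.sum_congr rfl fun r _ => ?_
  rw [← Finset.mul_prod_erase _ _ (Finset.mem_univ r), Matrix.updateRow_self]
  congr 1
  refine Finset.prod_congr rfl fun i hi => ?_
  rw [Matrix.updateRow_ne (Finset.ne_of_mem_erase hi)]

theorem IsHomogeneous.eq_zero_of_pderiv {σ K : Type*} [Fintype σ] [Field K] [CharZero K]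
    {G : MvPolynomial σ K} {d : ℕ} (hG : G.IsHomogeneous d) (hd : d ≠ 0)
    (h : ∀ i, pderiv i G = 0) : G = 0 := by
  have h1 := hG.sum_X_mul_pderiv
  simp only [h, mul_zero, Finset.sum_const_zero] at h1
  have h2 : (d : K) • G = 0 := by rw [Nat.cast_smul_eq_nsmul, ← h1]
  exact (smul_eq_zero.1 h2).resolve_left (Nat.cast_ne_zero.2 hd)

theorem isHomogeneous_diffOp_momentForm {K : Type*} [Field K] {n d : ℕ} (a : K)
    {G : MvPolynomial (Fin n) K} (hG : G.IsHomogeneous d) :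
    (diffOp (momentForm n a) G).IsHomogeneous (d - 1) := by
  rw [diffOp_momentForm]
  refine IsHomogeneous.sum _ _ _ fun j _ => ?_
  have h := (isHomogeneous_C (Fin n) (a ^ (j : ℕ))).mul (hG.pderiv (i := j))
  rwa [zero_add] at h

/-- A form is zero if its derivatives at `n` distinct points of the moment curve
in `K ^ n` vanish. -/
theorem eq_zero_of_diffOp_momentForm {K : Type*} [Field K] [CharZero K] {n d : ℕ}
    {β : Fin n → K} (hβ : Function.Injective β) {G : MvPolynomial (Fin n) K}
    (hG : G.IsHomogeneous d) (hd : d ≠ 0) (h : ∀ i, diffOp (momentForm n (β i)) G = 0) :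
    G = 0 := by
  refine IsHomogeneous.eq_zero_of_pderiv hG hd fun j => ?_
  have hinj : Function.Injective fun i => (C (β i) : MvPolynomial (Fin n) K) :=
    (C_injective _ _).comp hβ
  -- Vandermonde over the polynomial ring itself: the nodes are the constants `C (β i)`, the
  -- unknowns the partial derivatives.
  have := Matrix.eq_zero_of_forall_index_sum_pow_mul_eq_zero (v := fun j => pderiv j G) hinj
    fun i => by
      have := h i
      rw [diffOp_momentForm] at this
      simpa only [map_pow] using this
  exact congrFun this j

/-- By Lagrange interpolation the sum is the coefficient of X^(n-1) in X^d. -/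
theorem sum_nodalWeight_mul_pow {K : Type*} [Field K] {n d : ℕ} (hd : d + 1 < n)
    {α : Fin n → K} (hα : Function.Injective α) :
    ∑ i, Lagrange.nodalWeight Finset.univ α i * α i ^ d = 0 := by
  have h := Lagrange.coeff_eq_sum (s := Finset.univ) (v := α) hα.injOn
    (P := (Polynomial.X ^ d : Polynomial K))
    (by rw [Polynomial.degree_X_pow, Finset.card_univ, Fintype.card_fin]; exact_mod_cast by omega)
  rw [Polynomial.coeff_X_pow, if_neg (by simp; omega)] at h
  rw [h]
  refine Finset.sum_congr rfl fun i _ => ?_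
  simp [Lagrange.nodalWeight, div_eq_mul_inv, Finset.prod_inv_distrib, mul_comm]

theorem sum_nodalWeight_smul_momentForm {K : Type*} [Field K] {n e : ℕ} (he : e ≤ 1)
    {α : Fin (n + 2) → K} (hα : Function.Injective α) :
    ∑ i, (Lagrange.nodalWeight Finset.univ α i * α i ^ e) • momentForm n (α i) = 0 := by
  simp only [momentForm, Finset.smul_sum]
  rw [Finset.sum_comm]
  refine Finset.sum_eq_zero fun j _ => ?_
  have h := sum_nodalWeight_mul_pow (d := e + j) (by omega) hα
  simp only [MvPolynomial.C_mul', smul_smul, ← Finset.sum_smul, mul_assoc, ← pow_add, h, zero_smul]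

/-! ### The inverse system and its dimension -/

/-- `G` is a form of degree `k` that is killed by the linear forms at the first `m` points and by
the squares of the linear forms at the remaining points. -/
def IsInverseForm {K : Type*} [Field K] (n m k : ℕ) (α : Fin (n + 2) → K)
    (G : MvPolynomial (Fin n) K) : Prop :=
  G.IsHomogeneous k ∧
    (∀ i : Fin (n + 2), (i : ℕ) < m → diffOp (momentForm n (α i)) G = 0) ∧
    (∀ i : Fin (n + 2), m ≤ (i : ℕ) → diffOp (momentForm n (α i) ^ 2) G = 0)

theorem isHomogeneous_diffOp_prod_momentForm {K : Type*} [Field K] {n d : ℕ} {ι : Type*}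
    [DecidableEq ι] (α : ι → K) (S : Finset ι) {G : MvPolynomial (Fin n) K}
    (hG : G.IsHomogeneous d) :
    (diffOp (∏ i ∈ S, momentForm n (α i)) G).IsHomogeneous (d - S.card) := by
  induction S using Finset.induction_on with
  | empty => simpa using hG
  | insert a S ha ih =>
    rw [Finset.prod_insert ha, map_mul, Module.End.mul_apply, Finset.card_insert_of_notMem ha,
      ← Nat.sub_sub]
    exact isHomogeneous_diffOp_momentForm _ ih

namespace IsInverseForm

variable {K : Type*} [Field K] {n m k : ℕ} {α : Fin (n + 2) → K} {G G' : MvPolynomial (Fin n) K}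

theorem smul (h : IsInverseForm n m k α G) (c : K) : IsInverseForm n m k α (c • G) :=
  ⟨(homogeneousSubmodule (Fin n) K k).smul_mem c h.1,
    fun i hi => by rw [map_smul, h.2.1 i hi, smul_zero],
    fun i hi => by rw [map_smul, h.2.2 i hi, smul_zero]⟩

theorem sub (h : IsInverseForm n m k α G) (h' : IsInverseForm n m k α G') :
    IsInverseForm n m k α (G - G') :=
  ⟨h.1.sub h'.1,
    fun i hi => by rw [map_sub, h.2.1 i hi, h'.2.1 i hi, sub_zero],
    fun i hi => by rw [map_sub, h.2.2 i hi, h'.2.2 i hi, sub_zero]⟩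

/-- Differentiating at a point of `T` or at one of the first `m` points kills
`(∏ i ∈ T, ℓ i) ∘ G`. -/
theorem diffOp_mul_prod_eq_zero (h : IsInverseForm n m k α G) {T : Finset (Fin (n + 2))}
    {i : Fin (n + 2)} (hi : (i : ℕ) < m ∨ i ∈ T) :
    diffOp (momentForm n (α i) * ∏ j ∈ T, momentForm n (α j)) G = 0 := by
  by_cases him : (i : ℕ) < m
  · rw [mul_comm, map_mul, Module.End.mul_apply, h.2.1 i him, map_zero]
  · have hiT := hi.resolve_left him
    rw [← Finset.mul_prod_erase T _ hiT, ← mul_assoc, ← sq, mul_comm, map_mul,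
      Module.End.mul_apply, h.2.2 i (not_lt.1 him), map_zero]

theorem isDownSolution (h : IsInverseForm n m k α G) (hα : Function.Injective α) :
    IsDownSolution (Finset.univ.filter fun i : Fin (n + 2) => m ≤ (i : ℕ)) k α
      fun S => (∏ i ∈ S, Lagrange.nodalWeight Finset.univ α i) •
        diffOp (∏ i ∈ S, momentForm n (α i)) G := by
  intro T hT _
  set u := Lagrange.nodalWeight Finset.univ α with hu
  set N := Finset.univ.filter fun i : Fin (n + 2) => m ≤ (i : ℕ) with hN
  have key (e : ℕ) (he : e ≤ 1) : ∑ i ∈ N \ T, α i ^ e • (∏ j ∈ insert i T, u j) •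
      diffOp (∏ j ∈ insert i T, momentForm n (α j)) G = 0 := by
    have h1 : diffOp ((∑ i, (u i * α i ^ e) • momentForm n (α i)) *
        ∏ j ∈ T, momentForm n (α j)) G = 0 := by
      rw [sum_nodalWeight_smul_momentForm he hα, zero_mul, map_zero, LinearMap.zero_apply]
    rw [Finset.sum_mul, map_sum, LinearMap.sum_apply,
      ← Finset.sum_subset (Finset.subset_univ (N \ T))] at h1
    · rw [← smul_zero (∏ j ∈ T, u j), ← h1, Finset.smul_sum]
      refine Finset.sum_congr rfl fun i hi => ?_
      have hiT := (Finset.mem_sdiff.1 hi).2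
      rw [Finset.prod_insert hiT, Finset.prod_insert hiT, smul_mul_assoc, map_smul,
        LinearMap.smul_apply, smul_smul, smul_smul]
      congr 1
      ring
    · intro i _ hi
      have hi' : (i : ℕ) < m ∨ i ∈ T := by
        by_contra! hcon
        exact hi (Finset.mem_sdiff.2 ⟨by simp [hN, hcon.1], hcon.2⟩)
      rw [smul_mul_assoc, map_smul, LinearMap.smul_apply, h.diffOp_mul_prod_eq_zero hi',
        smul_zero]
  exact ⟨by simpa using key 0 zero_le_one, by simpa using key 1 le_rfl⟩

variable [CharZero K]

/-- Descent on |S| from k to 0: the derivatives of ℓ_S ∘ G at the first n points vanish, either by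
the annihilation conditions or because S grows, and n distinct points of the curve span. -/
theorem eq_zero_of_forall_diffOp_prod (h : IsInverseForm n m k α G) (hα : Function.Injective α)
    (hS : ∀ S : Finset (Fin (n + 2)), (∀ i ∈ S, m ≤ (i : ℕ)) → S.card = k →
      diffOp (∏ i ∈ S, momentForm n (α i)) G = 0) : G = 0 := by
  have main (d : ℕ) : ∀ S : Finset (Fin (n + 2)), (∀ i ∈ S, m ≤ (i : ℕ)) → S.card + d = k →
      diffOp (∏ i ∈ S, momentForm n (α i)) G = 0 := by
    induction d with
    | zero => exact hS
    | succ d ih =>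
      intro S hSm hSk
      refine eq_zero_of_diffOp_momentForm
        (β := fun i : Fin n => α (Fin.castLE (Nat.le_add_right n 2) i))
        (hα.comp (Fin.castLE_injective _)) (isHomogeneous_diffOp_prod_momentForm α S h.1)
        (by omega) fun i => ?_
      set i' : Fin (n + 2) := Fin.castLE (Nat.le_add_right n 2) i
      rw [← Module.End.mul_apply, ← map_mul]
      by_cases hi : (i' : ℕ) < m ∨ i' ∈ S
      · exact h.diffOp_mul_prod_eq_zero hi
      · push Not at hi
        rw [← Finset.prod_insert (f := fun i => momentForm n (α i)) hi.2]
        refine ih _ ?_ (by rw [Finset.card_insert_of_notMem hi.2]; omega)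
        intro j hj
        rcases Finset.mem_insert.1 hj with rfl | hj
        · exact hi.1
        · exact hSm j hj
  simpa using main k ∅ (by simp) (by simp)

/-- A form in the inverse system is determined by a single mixed derivative. -/
theorem eq_zero_of_diffOp_prod (h : IsInverseForm n m k α G) (hα : Function.Injective α)
    (hmn : m + 2 * k = n + 1) {S₀ : Finset (Fin (n + 2))} (hS₀ : ∀ i ∈ S₀, m ≤ (i : ℕ))
    (hS₀k : S₀.card = k) (h0 : diffOp (∏ i ∈ S₀, momentForm n (α i)) G = 0) : G = 0 := by
  refine h.eq_zero_of_forall_diffOp_prod hα fun S hS hSk => ?_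
  have hN : (Finset.univ.filter fun i : Fin (n + 2) => m ≤ (i : ℕ)).card = 2 * k + 1 := by
    have h1 := Fin.card_filter_val_lt (n := n + 2) (m := m)
    have h2 := Finset.card_filter_add_card_filter_not (s := (Finset.univ : Finset (Fin (n + 2))))
      (fun i : Fin (n + 2) => (i : ℕ) < m)
    simp only [not_lt, Finset.card_univ, Fintype.card_fin] at h2
    rw [h1] at h2
    omega
  have h1 := IsDownSolution.eq_zero k _ α _ S₀ hN hα.injOn (h.isDownSolution hα)
    (fun i hi => by simpa using hS₀ i hi) hS₀k (by simp only [h0, smul_zero]) S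
    (fun i hi => by simpa using hS i hi) hSk
  exact (smul_eq_zero.1 h1).resolve_left <| Finset.prod_ne_zero_iff.2 fun i _ =>
    Lagrange.nodalWeight_ne_zero hα.injOn (Finset.mem_univ i)

/-- The inverse system is at most one-dimensional. -/
theorem exists_eq_smul (h : IsInverseForm n m k α G) (h' : IsInverseForm n m k α G')
    (hα : Function.Injective α) (hmn : m + 2 * k = n + 1) (hG' : G' ≠ 0) :
    ∃ c : K, G = c • G' := by
  -- Any k indices ≥ m would serve; these are m, …, m+k-1.
  let S₀ : Finset (Fin (n + 2)) := Finset.univ.map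
    ⟨fun i : Fin k => ⟨m + i, by omega⟩, fun i j hij => by simpa [Fin.ext_iff] using hij⟩
  have hS₀ : ∀ i ∈ S₀, m ≤ (i : ℕ) := by
    intro i hi
    simp only [S₀, Finset.mem_map] at hi
    obtain ⟨j, -, rfl⟩ := hi
    exact Nat.le_add_right _ _
  have hS₀k : S₀.card = k := by simp [S₀]
  have hC {P : MvPolynomial (Fin n) K} (hP : IsInverseForm n m k α P) :
      ∃ c : K, diffOp (∏ i ∈ S₀, momentForm n (α i)) P = C c := by
    have h1 := isHomogeneous_diffOp_prod_momentForm α S₀ hP.1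
    rw [hS₀k, Nat.sub_self] at h1
    exact ⟨_, totalDegree_eq_zero_iff_eq_C.1 ((totalDegree_zero_iff_isHomogeneous _).2 h1)⟩
  obtain ⟨a, ha⟩ := hC h
  obtain ⟨b, hb⟩ := hC h'
  have hb0 : b ≠ 0 := by
    rintro rfl
    exact hG' (h'.eq_zero_of_diffOp_prod hα hmn hS₀ hS₀k (by rw [hb, C_0]))
  refine ⟨a / b, sub_eq_zero.1 ?_⟩
  refine (h.sub (h'.smul (a / b))).eq_zero_of_diffOp_prod hα hmn hS₀ hS₀k ?_
  rw [map_sub, map_smul, ha, hb, smul_eq_C_mul, ← C_mul, div_mul_cancel₀ _ hb0, sub_self]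

end IsInverseForm

/-! ### The Vandermonde–Hankel determinant -/

section VandermondeHankel

variable {K : Type*} [Field K] {n k : ℕ}

theorem vandermondeHankel_apply_of_lt (hkn : 2 * k ≤ n + 1) (α : Fin (n + 2) → K)
    {r : Fin (n + 1 - k)} (h : (r : ℕ) < n + 1 - 2 * k) (c : Fin (n + 1 - k)) :
    vandermondeHankel n k hkn α r c = C (α ⟨r, by omega⟩ ^ (c : ℕ)) :=
  dif_pos h

theorem vandermondeHankel_apply_of_not_lt (hkn : 2 * k ≤ n + 1) (α : Fin (n + 2) → K)
    {r : Fin (n + 1 - k)} (h : ¬ (r : ℕ) < n + 1 - 2 * k) (c : Fin (n + 1 - k)) :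
    vandermondeHankel n k hkn α r c = X ⟨(r : ℕ) - (n + 1 - 2 * k) + c, by omega⟩ :=
  dif_neg h

theorem isHomogeneous_det_vandermondeHankel (hkn : 2 * k ≤ n + 1) (α : Fin (n + 2) → K) :
    (vandermondeHankel n k hkn α).det.IsHomogeneous k := by
  have hsum : ∑ r : Fin (n + 1 - k), (if (r : ℕ) < n + 1 - 2 * k then 0 else 1) = k := by
    rw [Fin.sum_univ_eq_sum_range (fun r => if r < n + 1 - 2 * k then 0 else 1),
      show n + 1 - k = (n + 1 - 2 * k) + k by omega, Finset.sum_range_add,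
      Finset.sum_eq_zero fun i hi => if_pos (Finset.mem_range.1 hi)]
    simp
  rw [← Matrix.det_transpose, Matrix.det_apply]
  refine IsHomogeneous.sum _ _ _ fun σ _ => ?_
  rw [Units.smul_def, ← Int.cast_smul_eq_zsmul K]
  refine (homogeneousSubmodule (Fin n) K k).smul_mem _ ?_
  rw [mem_homogeneousSubmodule]
  have := IsHomogeneous.prod Finset.univ
    (fun r => vandermondeHankel n k hkn α r (σ r))
    (fun r => if (r : ℕ) < n + 1 - 2 * k then 0 else 1) fun r _ => by
      by_cases h : (r : ℕ) < n + 1 - 2 * k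
      · rw [vandermondeHankel_apply_of_lt hkn α h, if_pos h]
        exact isHomogeneous_C _ _
      · rw [vandermondeHankel_apply_of_not_lt hkn α h, if_neg h]
        exact isHomogeneous_X _ _
  rwa [hsum] at this

/-- Differentiation at the point with parameter `a` turns a Vandermonde row into zero and a Hankel
row into a multiple of the Vandermonde row of `a`. -/
theorem momentDerivation_vandermondeHankel (hkn : 2 * k ≤ n + 1) (α : Fin (n + 2) → K) (a : K)
    (r c : Fin (n + 1 - k)) :
    momentDerivation n a (vandermondeHankel n k hkn α r c) =
      (if (r : ℕ) < n + 1 - 2 * k then 0 else C (a ^ ((r : ℕ) - (n + 1 - 2 * k)))) *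
        C (a ^ (c : ℕ)) := by
  by_cases h : (r : ℕ) < n + 1 - 2 * k
  · rw [vandermondeHankel_apply_of_lt hkn α h, if_pos h, zero_mul, momentDerivation,
      derivation_C]
  · rw [vandermondeHankel_apply_of_not_lt hkn α h, if_neg h, momentDerivation, mkDerivation_X,
      ← C_mul, pow_add]

theorem momentDerivation_det_vandermondeHankel (hkn : 2 * k ≤ n + 1) (α : Fin (n + 2) → K)
    (a : K) :
    momentDerivation n a (vandermondeHankel n k hkn α).det =
      ∑ r : Fin (n + 1 - k),
        (if (r : ℕ) < n + 1 - 2 * k then 0 else C (a ^ ((r : ℕ) - (n + 1 - 2 * k)))) *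
          ((vandermondeHankel n k hkn α).updateRow r fun c => C (a ^ (c : ℕ))).det := by
  rw [Derivation.map_det]
  refine Finset.sum_congr rfl fun r _ => ?_
  rw [← Matrix.det_updateRow_smul]
  congr 2
  funext c
  rw [momentDerivation_vandermondeHankel]
  rfl

theorem isInverseForm_det_vandermondeHankel (hkn : 2 * k ≤ n + 1) (α : Fin (n + 2) → K) :
    IsInverseForm n (n + 1 - 2 * k) k α (vandermondeHankel n k hkn α).det := by
  refine ⟨isHomogeneous_det_vandermondeHankel hkn α, fun i hi => ?_, fun i _ => ?_⟩
  · rw [diffOp_momentForm_eq, momentDerivation_det_vandermondeHankel]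
    refine Finset.sum_eq_zero fun r _ => ?_
    by_cases hr : (r : ℕ) < n + 1 - 2 * k
    · rw [if_pos hr, zero_mul]
    · have hne : (⟨i, by omega⟩ : Fin (n + 1 - k)) ≠ r := by
        intro h
        exact hr (h ▸ hi)
      rw [Matrix.det_zero_of_row_eq hne, mul_zero]
      rw [Matrix.updateRow_self, Matrix.updateRow_ne hne]
      funext c
      rw [vandermondeHankel_apply_of_lt hkn α hi]
  · set a := α i
    rw [sq, map_mul, Module.End.mul_apply, diffOp_momentForm_eq, diffOp_momentForm_eq,
      momentDerivation_det_vandermondeHankel, map_sum]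
    refine Finset.sum_eq_zero fun r _ => ?_
    have hcoef : momentDerivation n a (if (r : ℕ) < n + 1 - 2 * k then 0 else
        C (a ^ ((r : ℕ) - (n + 1 - 2 * k)))) = 0 := by
      split_ifs
      · exact map_zero _
      · exact derivation_C _ _
    rw [Derivation.leibniz, hcoef, smul_zero, add_zero, Derivation.map_det, Finset.sum_eq_zero,
      smul_zero]
    intro s _
    by_cases hsr : s = r
    · subst hsr
      refine Matrix.det_eq_zero_of_row_eq_zero s fun c => ?_
      rw [Matrix.updateRow_self, Matrix.updateRow_self]
      exact derivation_C _ _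
    -- A second differentiated row is proportional to the row (1, a, a², …) already placed at `r`.
    · have hrow : (fun c => momentDerivation n a
          ((vandermondeHankel n k hkn α).updateRow r (fun c => C (a ^ (c : ℕ))) s c)) =
          (if (s : ℕ) < n + 1 - 2 * k then 0 else
            C (a ^ ((s : ℕ) - (n + 1 - 2 * k))) : MvPolynomial (Fin n) K) •
            fun c : Fin (n + 1 - k) => (C (a ^ (c : ℕ)) : MvPolynomial (Fin n) K) := by
        funext c
        rw [Matrix.updateRow_ne hsr, momentDerivation_vandermondeHankel]
        rfl
      rw [hrow, Matrix.det_updateRow_smul, Matrix.det_zero_of_row_eq hsr, mul_zero]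
      rw [Matrix.updateRow_self, Matrix.updateRow_ne (Ne.symm hsr), Matrix.updateRow_self]

theorem det_vandermondeHankel_ne_zero (hkn : 2 * k ≤ n + 1) {α : Fin (n + 2) → K}
    (hα : Function.Injective α) : (vandermondeHankel n k hkn α).det ≠ 0 := by
  intro hdet
  have hle : n + 1 - k ≤ n + 2 := by omega
  obtain ⟨m, hm⟩ : ∃ m, m = n + 1 - 2 * k := ⟨_, rfl⟩
  let β : Fin k → K := fun i => α ⟨m + i, by omega⟩
  have hβ : Function.Injective β := fun i j hij => by
    simpa [Fin.ext_iff] using hα hij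
  -- At this sum of k moment-curve points, Hankel row s becomes ∑_i β_i^s (1, β_i, β_i², …).
  let φ : MvPolynomial (Fin n) K →+* K := eval fun j => ∑ i, β i ^ (j : ℕ)
  have h1 : (φ.mapMatrix (vandermondeHankel n k hkn α)).det = 0 := by
    rw [← RingHom.map_det, hdet, map_zero]
  obtain ⟨p, hp0, hp⟩ := Matrix.exists_mulVec_eq_zero_iff.2 h1
  have hpr (r : Fin (n + 1 - k)) : ∑ c, φ (vandermondeHankel n k hkn α r c) * p c = 0 :=
    congrFun hp r
  -- the polynomial with coefficients `p` vanishes at `n + 1 - k` distinct points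
  let P : K → K := fun x => ∑ c : Fin (n + 1 - k), p c * x ^ (c : ℕ)
  have hP1 (r : Fin (n + 1 - k)) (hr : (r : ℕ) < m) : P (α ⟨r, r.2.trans_le hle⟩) = 0 := by
    rw [← hpr r]
    refine Finset.sum_congr rfl fun c _ => ?_
    rw [vandermondeHankel_apply_of_lt hkn α (hm ▸ hr), mul_comm]
    exact congrArg (· * p c) (eval_C _).symm
  -- The Hankel rows say ∑_i β_i^s P(β_i) = 0 for s < k, a k × k Vandermonde system in the values
  -- P(β_i).
  have hP2 : (fun i => P (β i)) = 0 := by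
    refine Matrix.eq_zero_of_forall_pow_sum_mul_pow_eq_zero hβ fun s => ?_
    have hr : ¬ ((⟨m + s, by omega⟩ : Fin (n + 1 - k)) : ℕ) < m := by simp
    rw [← hpr ⟨m + s, by omega⟩]
    simp only [P, Finset.sum_mul]
    rw [Finset.sum_comm]
    refine Finset.sum_congr rfl fun c _ => ?_
    rw [vandermondeHankel_apply_of_not_lt hkn α (hm ▸ hr)]
    simp only [φ, eval_X, Finset.sum_mul]
    refine Finset.sum_congr rfl fun i _ => ?_
    rw [← hm, Nat.add_sub_cancel_left, pow_add]
    ring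
  refine hp0 <| Matrix.eq_zero_of_forall_index_sum_mul_pow_eq_zero
    (f := fun r : Fin (n + 1 - k) => α (Fin.castLE hle r))
    (hα.comp (Fin.castLE_injective _)) fun r => ?_
  by_cases hr : (r : ℕ) < m
  · exact hP1 r hr
  · have h2 := congrFun hP2 ⟨r - m, by omega⟩
    have h3 : (Fin.castLE hle r : Fin (n + 2)) = ⟨m + (r - m), by omega⟩ :=
      Fin.ext (by simp; omega)
    rw [h3]
    exact h2

end VandermondeHankel

theorem theorem5p3 {K : Type*} [Field K] [CharZero K] (n k : ℕ) (hk : 0 < k)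
    (hkn : 2 * k ≤ n + 1) (α : Fin (n + 2) → K) (hα : Function.Injective α) :
    (vandermondeHankel n k hkn α).det ≠ 0 ∧
    ∀ G : MvPolynomial (Fin n) K,
      (G.IsHomogeneous k ∧
        (∀ i : Fin (n + 2), (i : ℕ) < n + 1 - 2 * k →
          InverseSystem.diffOp (momentForm n (α i)) G = 0) ∧
        (∀ i : Fin (n + 2), n + 1 - 2 * k ≤ (i : ℕ) →
          InverseSystem.diffOp (momentForm n (α i) ^ 2) G = 0)) ↔
      ∃ c : K, G = c • (vandermondeHankel n k hkn α).det := by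
  have hF := isInverseForm_det_vandermondeHankel hkn α
  have hF0 := det_vandermondeHankel_ne_zero hkn hα
  refine ⟨hF0, fun G => ⟨fun hG => ?_, ?_⟩⟩
  · exact IsInverseForm.exists_eq_smul hG hF hα (by omega) hF0
  · rintro ⟨c, rfl⟩
    exact hF.smul c
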